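/- Let $G$ be a real Lie group with Lie algebra $\mathfrak g$, let $H\subseteq G$ be a closed subgroup, and let $M=H\backslash G$ be the homogeneous space of right cosets $Hg$ with its quotient manifold structure, on which $G$ acts by $(Hx)\cdot g=Hxg$. For $a\in\mathfrak g$ let $a^\pi$ be the vector field on $M$ generated by $a$ (the projection of the left-invariant vector field of $a$). Let $C=\sum C^{ab}\,V_a\otimes V_b\in \mathrm{Sym}^2\mathfrak g$ be a symmetric tensor, let $C^\pi=\sum C^{ab}\,V_a^\pi\otimes V_b^\pi$ be the corresponding symmetric contravariant tensor field on $M$, and let $M_0\subseteq M$ be the open set where $C^\pi$ is non-degenerate. Regard $M_0$ as a pseudo-Riemannian manifold whose metric tensor has $C^\pi$ as its contravariant form (a Lie-algebraic metric). Theorem. Let $\Lambda$ be a $G$-invariant foliation of $M$, i.e. a $G$-invariant, completely integrable smooth distribution on $M$. Then the perpendicular distribution $\Lambda^\perp=\{v\in TM_0 : v\perp\Lambda\}$ is totally geodesic: if a geodesic of $M_0$, defined on any open interval, is tangent to $\Lambda^\perp$ at one point, then it is tangent to $\Lambda^\perp$ at every point. -/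

import Mathlib

open scoped Manifold ContDiff TensorProduct

noncomputable section

namespace LieAlgebraicMetric

/-! ### Pseudo-Riemannian geometry on an open part of a manifold -/

section Geometry

variable {F : Type*} [NormedAddCommGroup F] [NormedSpace ℝ F]
  {M : Type*} [TopologicalSpace M] [ChartedSpace F M]

/-- A distribution: a linear subspace of every tangent space. -/
abbrev Distribution (F M : Type*) [NormedAddCommGroup F] [NormedSpace ℝ F]
    [TopologicalSpace M] [ChartedSpace F M] : Type _ :=
  (p : M) → Submodule ℝ (TangentSpace 𝓘(ℝ, F) p)

/-- A field of bilinear forms on the tangent spaces (a covariant 2-tensor field). -/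
abbrev BilinField (F M : Type*) [NormedAddCommGroup F] [NormedSpace ℝ F]
    [TopologicalSpace M] [ChartedSpace F M] : Type _ :=
  (p : M) → TangentSpace 𝓘(ℝ, F) p →ₗ[ℝ] TangentSpace 𝓘(ℝ, F) p →ₗ[ℝ] ℝ

/-- The (smooth) distribution `Λ` is a foliation, i.e. it is completely integrable: near every
point it is the field of tangent spaces to the level sets of a smooth submersion into some `ℝᵏ`. -/
def IsFoliation (Λ : Distribution F M) : Prop :=
  ∀ p : M, ∃ (k : ℕ) (U : Set M) (f : M → EuclideanSpace ℝ (Fin k)),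
    IsOpen U ∧ p ∈ U ∧ ContMDiffOn 𝓘(ℝ, F) 𝓘(ℝ, EuclideanSpace ℝ (Fin k)) ∞ f U ∧
    ∀ x ∈ U, Function.Surjective (mfderiv 𝓘(ℝ, F) 𝓘(ℝ, EuclideanSpace ℝ (Fin k)) f x) ∧
      ∀ v : TangentSpace 𝓘(ℝ, F) x,
        v ∈ Λ x ↔ mfderiv 𝓘(ℝ, F) 𝓘(ℝ, EuclideanSpace ℝ (Fin k)) f x v = 0

/-- The perpendicular distribution `Λ^⊥` of `Λ` relative to `g`. -/
def perp (g : BilinField F M) (Λ : Distribution F M) : Distribution F M := fun p =>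
  { carrier := {v | ∀ u ∈ Λ p, g p v u = 0}
    zero_mem' := by
      intro u _
      simp
    add_mem' := by
      intro v w hv hw u hu
      rw [map_add, LinearMap.add_apply, hv u hu, hw u hu, add_zero]
    smul_mem' := by
      intro c v hv u hu
      rw [map_smul, LinearMap.smul_apply, hv u hu, smul_zero] }

/-- The components `g_y(u, v)` of `g` in the chart `c`, at `y ∈ c.target`. -/
def metricInChart (g : BilinField F M) (c : OpenPartialHomeomorph M F) (y u v : F) : ℝ :=
  g (c.symm y) (mfderiv 𝓘(ℝ, F) 𝓘(ℝ, F) c.symm y u) (mfderiv 𝓘(ℝ, F) 𝓘(ℝ, F) c.symm y v)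

/-- The Christoffel symbols of the first kind of the Levi-Civita connection of `g` in the
chart `c`: `½ (∂_u g(v, w) + ∂_v g(u, w) - ∂_w g(u, v))`, which is `g(∇_u v, w)` for constant
vector fields `u`, `v`, `w` in the chart. -/
def christoffelFirst (g : BilinField F M) (c : OpenPartialHomeomorph M F) (y u v w : F) : ℝ :=
  (fderiv ℝ (fun z => metricInChart g c z v w) y u
    + fderiv ℝ (fun z => metricInChart g c z u w) y v
    - fderiv ℝ (fun z => metricInChart g c z u v) y w) / 2

/-- The curve `γ`, defined on the open interval `J`, is a geodesic of the pseudo-Riemannian metric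
`g`, which lives on the open set `U`: it is `C²`, runs in `U`, and in every chart its coordinate
expression `x = c ∘ γ` solves the geodesic equation `x'' + Γ(x', x') = 0`, which is written here
with the index lowered, as `g(x'', w) + g(Γ(x', x'), w) = 0` for all `w`. -/
structure IsGeodesicOn (g : BilinField F M) (U : Set M) (γ : ℝ → M) (J : Set ℝ) : Prop where
  contMDiffOn : ContMDiffOn 𝓘(ℝ, ℝ) 𝓘(ℝ, F) 2 γ J
  mapsTo : Set.MapsTo γ J U
  geodesic_eq : ∀ c ∈ atlas F M, ∀ t ∈ J, γ t ∈ c.source → ∀ w : F,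
    metricInChart g c (c (γ t)) (deriv (deriv (fun s => c (γ s))) t) w
      + christoffelFirst g c (c (γ t)) (deriv (fun s => c (γ s)) t)
          (deriv (fun s => c (γ s)) t) w = 0

/-- The velocity vector of a curve. -/
def velocity (γ : ℝ → M) (t : ℝ) : TangentSpace 𝓘(ℝ, F) (γ t) :=
  mfderiv 𝓘(ℝ, ℝ) 𝓘(ℝ, F) γ t (1 : ℝ)

/-- The distribution `D` is totally geodesic for the pseudo-Riemannian metric `g` on the open
set `U`: a geodesic, defined on any open interval `J`, that is tangent to `D` at one point is
everywhere tangent to `D`. -/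
def IsTotallyGeodesicOn (g : BilinField F M) (U : Set M) (D : Distribution F M) : Prop :=
  ∀ (J : Set ℝ) (γ : ℝ → M), IsOpen J → IsPreconnected J → IsGeodesicOn g U γ J →
    (∃ t₀ ∈ J, velocity (F := F) γ t₀ ∈ D (γ t₀)) →
    ∀ t ∈ J, velocity (F := F) γ t ∈ D (γ t)

end Geometry

/-! ### The homogeneous space of right cosets -/

section Cosets

variable {G : Type*} [Group G] (H : Subgroup G)

/-- The homogeneous space `H \ G` of right cosets `H g` (with the quotient topology if `G` is a
topological group). -/
abbrev RightCosetSpace : Type _ := Quotient (QuotientGroup.rightRel H)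

/-- The canonical projection `G → H \ G`, `g ↦ H g`. -/
def proj (g : G) : RightCosetSpace H := Quotient.mk _ g

/-- The action of `G` on right cosets: `translate H g (H x) = H x g`. -/
def translate (g : G) : RightCosetSpace H → RightCosetSpace H :=
  Quotient.map' (fun x => x * g) (by
    intro x y h
    rw [QuotientGroup.rightRel_apply] at h ⊢
    simpa [mul_assoc] using h)

theorem translate_proj (g x : G) : translate H g (proj H x) = proj H (x * g) := rfl

end Cosets

/-! ### Lie-algebraic metrics -/

section Metric

variable {E F G : Type*} [NormedAddCommGroup E] [NormedSpace ℝ E]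
  [NormedAddCommGroup F] [NormedSpace ℝ F]
  [TopologicalSpace G] [ChartedSpace E G] [Group G]

/-- The given charts make `H \ G` the quotient manifold of the Lie group `G`: the canonical
projection is a smooth submersion. (There is exactly one such smooth structure if `H` is closed.) -/
def IsQuotientManifold (E F : Type*) [NormedAddCommGroup E] [NormedSpace ℝ E]
    [NormedAddCommGroup F] [NormedSpace ℝ F] {G : Type*} [TopologicalSpace G] [ChartedSpace E G]
    [Group G] (H : Subgroup G) [ChartedSpace F (RightCosetSpace H)] : Prop :=
  Manifold.IsSubmersion 𝓘(ℝ, E) 𝓘(ℝ, F) ∞ (proj H)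

variable {H : Subgroup G} [ChartedSpace F (RightCosetSpace H)]

/-- The distribution `Λ` on `H \ G` is invariant under the action of `G`. -/
def IsInvariant (Λ : Distribution F (RightCosetSpace H)) : Prop :=
  ∀ (g : G) (p : RightCosetSpace H),
    (Λ p).map (mfderiv 𝓘(ℝ, F) 𝓘(ℝ, F) (translate H g) p).toLinearMap = Λ (translate H g p)

variable (F) in
/-- The value at `p` of the vector field on `H \ G` by which `a ∈ 𝔤` acts, as a linear function
of `a`: it is the derivative at `1` of the orbit map `g ↦ p g`. As `generator_proj` says, this
vector field is the projection of the left-invariant vector field of `a`. -/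
def generator (p : RightCosetSpace H) : GroupLieAlgebra 𝓘(ℝ, E) G →ₗ[ℝ] TangentSpace 𝓘(ℝ, F) p :=
  let ψ : TangentSpace 𝓘(ℝ, E) (1 : G) →L[ℝ] TangentSpace 𝓘(ℝ, F) (translate H 1 p) :=
    mfderiv 𝓘(ℝ, E) 𝓘(ℝ, F) (fun g : G => translate H g p) 1
  ψ.toLinearMap

theorem generator_proj [LieGroup 𝓘(ℝ, E) ∞ G] (hπ : IsQuotientManifold E F H) (q : G)
    (a : GroupLieAlgebra 𝓘(ℝ, E) G) :
    (generator F (proj H q) a : F) =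
      (mfderiv 𝓘(ℝ, E) 𝓘(ℝ, F) (proj H) q (mulInvariantVectorField a q) : F) := by
  have h1 : MDifferentiableAt 𝓘(ℝ, E) 𝓘(ℝ, F) (proj H) (q * 1) :=
    (Manifold.IsSubmersion.contMDiff hπ).contMDiffAt.mdifferentiableAt (by simp)
  have h2 : MDifferentiableAt 𝓘(ℝ, E) 𝓘(ℝ, E) (fun g : G => q * g) 1 :=
    (contMDiff_mul_left (I := 𝓘(ℝ, E)) (n := ∞)).contMDiffAt.mdifferentiableAt (by simp)
  have h3 := mfderiv_comp (1 : G) h1 h2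
  have h4 : (proj H) ∘ (fun g : G => q * g) = fun g => translate H g (proj H q) := rfl
  rw [h4] at h3
  have h5 := DFunLike.congr_fun h3 a
  rw [mul_one] at h5
  exact h5

/-- The contravariant tensor field on `H \ G` which is the projection of the left-invariant tensor
field of `C ∈ 𝔤 ⊗ 𝔤`: if `C = ∑ Cᵃᵇ V_a ⊗ V_b`, its value at `p` is `∑ Cᵃᵇ V_a(p) ⊗ V_b(p)`. -/
def tensorField (C : GroupLieAlgebra 𝓘(ℝ, E) G ⊗[ℝ] GroupLieAlgebra 𝓘(ℝ, E) G)
    (p : RightCosetSpace H) : TangentSpace 𝓘(ℝ, F) p ⊗[ℝ] TangentSpace 𝓘(ℝ, F) p :=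
  TensorProduct.map (generator F p) (generator F p) C

/-- Contraction of the tensor field of `C` at `p` with covectors: a linear map from the cotangent
space to the tangent space at `p`. -/
def sharp (C : GroupLieAlgebra 𝓘(ℝ, E) G ⊗[ℝ] GroupLieAlgebra 𝓘(ℝ, E) G)
    (p : RightCosetSpace H) :
    Module.Dual ℝ (TangentSpace 𝓘(ℝ, F) p) →ₗ[ℝ] TangentSpace 𝓘(ℝ, F) p where
  toFun ξ := TensorProduct.lid ℝ _ (LinearMap.rTensor _ ξ (tensorField C p))
  map_add' ξ η := by
    rw [LinearMap.rTensor_add, LinearMap.add_apply, map_add]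
  map_smul' r ξ := by
    rw [LinearMap.rTensor_smul, LinearMap.smul_apply, map_smul, RingHom.id_apply]

variable (F H) in
/-- The part of `H \ G` where the tensor field of `C` is non-degenerate. -/
def nondegenerateLocus (C : GroupLieAlgebra 𝓘(ℝ, E) G ⊗[ℝ] GroupLieAlgebra 𝓘(ℝ, E) G) :
    Set (RightCosetSpace H) :=
  {p | Function.Bijective (sharp (F := F) C p)}

open Classical in
variable (F H) in
/-- The Lie-algebraic metric of `C`: the covariant form, i.e. the inverse, of the tensor field
of `C`, on the locus where that is non-degenerate (and `0` elsewhere). -/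
def metric (C : GroupLieAlgebra 𝓘(ℝ, E) G ⊗[ℝ] GroupLieAlgebra 𝓘(ℝ, E) G) :
    BilinField F (RightCosetSpace H) := fun p =>
  if h : Function.Bijective (sharp (F := F) C p) then
    (LinearEquiv.ofBijective (sharp (F := F) C p) h).symm.toLinearMap
  else 0

end Metric

end LieAlgebraicMetric

end

/-!
The theorem holds because, along a geodesic of `M₀`, perpendicularity to `Λ` is governed by
a homogeneous linear differential equation.

In a chart let `S y : ξ ↦ ∑ ξ(Vᵢ) Wᵢ` be the cometric of `C = ∑ aᵢ ⊗ bᵢ`, where `Vᵢ` and `Wᵢ` are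
the vector fields by which `aᵢ` and `bᵢ` act. The momentum `p = g(x', ·)` of a geodesic `x`
satisfies Hamilton's equations `x' = S p` and `p'(w) = -½ p((∂_w S) p)` (`hasDerivAt_momentum`).
Near a point the distribution `Λ` is the kernel of the derivative `D` of a submersion, and hence
the image of a smooth family of projections `P` (`exists_proj_ker`). The velocity is perpendicular
to `Λ` exactly when `q = p ∘ P` vanishes. Differentiating, and writing `x'` both as `∑ p(Vᵢ) Wᵢ`
and as `∑ p(Wᵢ) Vᵢ`, which is possible since `C` is symmetric, gives
`q'(w) = ½ ∑ (p(Vᵢ) p([Wᵢ, P w]) + p(Wᵢ) p([Vᵢ, P w]))` (`hasDerivAt_momentum_proj`).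

The fields `Vᵢ` and `Wᵢ` are infinitesimal generators of transformations that preserve `Λ`, so the
brackets `[Vᵢ, P w]` and `[Wᵢ, P w]` are again sections of `Λ` (`lie_derivative_eq_zero`,
`apply_bracketProj_eq_zero`). Therefore `p` may be replaced by `q` in front of the brackets, and
`q' = A(t) q` with `A` continuous. By uniqueness of solutions, `q` vanishes near a time either
identically or nowhere (`exists_nhds_forall_perp_ker`), and connectedness of the interval finishes
the proof.

To apply this on `H \ G`, the action `(g, p) ↦ p g` has to be smooth, which follows from the
existence of smooth local sections of the submersion `G → H \ G` (`exists_contMDiffAt_section`,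
`contMDiff_translate`).
-/

namespace LieAlgebraicMetric
open Filter Topology

/-! ### Linear differential equations -/

/-- Near a time at which the coefficient of a homogeneous linear differential equation is
continuous, a solution that vanishes once vanishes throughout. -/
theorem exists_nhds_forall_eq_zero_of_linear_ode {X : Type*} [NormedAddCommGroup X]
    [NormedSpace ℝ X] {q : ℝ → X} {A : ℝ → X →L[ℝ] X} {t₁ : ℝ} (hA : ContinuousAt A t₁)
    (hq : ∀ᶠ t in 𝓝 t₁, HasDerivAt q (A t (q t)) t) :
    ∃ N ∈ 𝓝 t₁, ∀ s ∈ N, ∀ t ∈ N, q s = 0 → q t = 0 := by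
  have hb : ∀ᶠ t in 𝓝 t₁, ‖A t‖₊ < ‖A t₁‖₊ + 1 :=
    hA.nnnorm.eventually_lt continuousAt_const (lt_add_of_pos_right _ one_pos)
  obtain ⟨ε, hε, h⟩ := Metric.eventually_nhds_iff_ball.1 (hq.and hb)
  refine ⟨Metric.ball t₁ ε, Metric.ball_mem_nhds _ hε, fun s hs t ht hqs => ?_⟩
  rw [Real.ball_eq_Ioo] at h hs ht
  refine ODE_solution_unique_of_mem_Ioo (v := fun t z => A t z) (s := fun _ => Set.univ)
    (K := ‖A t₁‖₊ + 1) (g := fun _ => 0) (fun t ht => ?_) hs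
    (fun t ht => ⟨(h t ht).1, trivial⟩) (fun t _ => ⟨?_, trivial⟩) hqs ht
  · exact ((A t).lipschitz.weaken (h t ht).2.le).lipschitzOnWith
  · simpa using hasDerivAt_const t (0 : X)

/-! ### Momentum of geodesics in a chart -/

section Momentum

variable {F : Type*} [NormedAddCommGroup F] [NormedSpace ℝ F]

/-- Hamilton's equation for the momentum `g(x', ·)` of a geodesic `x`: if `S` is the inverse of the
metric `B`, then `p'(w) = -½ p((∂_w S) p)`. -/
theorem hasDerivAt_momentum {B : F → F →L[ℝ] F →L[ℝ] ℝ} {S : F → (F →L[ℝ] ℝ) →L[ℝ] F}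
    {x : ℝ → F} {t : ℝ} {a : F}
    (hx : HasDerivAt x (deriv x t) t) (hx' : HasDerivAt (deriv x) a t)
    (hB : DifferentiableAt ℝ B (x t)) (hS : DifferentiableAt ℝ S (x t))
    (hBS : ∀ᶠ y in 𝓝 (x t), ∀ ξ, B y (S y ξ) = ξ)
    (hSB : S (x t) (B (x t) (deriv x t)) = deriv x t)
    (hsymm : ∀ u v, B (x t) u v = B (x t) v u)
    (hgeo : ∀ w, B (x t) a w
      + (fderiv ℝ B (x t) (deriv x t) (deriv x t) w
        + fderiv ℝ B (x t) (deriv x t) (deriv x t) w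
        - fderiv ℝ B (x t) w (deriv x t) (deriv x t)) / 2 = 0) :
    ∃ p' : F →L[ℝ] ℝ, HasDerivAt (fun s => B (x s) (deriv x s)) p' t ∧
      ∀ w, p' w = -(1 / 2) * B (x t) (deriv x t)
        (fderiv ℝ S (x t) w (B (x t) (deriv x t))) := by
  have h1 : HasDerivAt (fun s => B (x s)) (fderiv ℝ B (x t) (deriv x t)) t :=
    HasFDerivAt.comp_hasDerivAt (l := B) (f := x) t hB.hasFDerivAt hx
  refine ⟨_, h1.clm_apply hx', fun w => ?_⟩
  set p := B (x t) (deriv x t) with hp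
  -- the derivative of `B` is obtained from that of `S` by differentiating `B (S p) = p`
  have h2 : HasFDerivAt (fun y => B y (S y p)) (0 : F →L[ℝ] F →L[ℝ] ℝ) (x t) :=
    (hasFDerivAt_const p (x t)).congr_of_eventuallyEq (hBS.mono fun y hy => hy p)
  have h3 := hB.hasFDerivAt.clm_apply (hS.hasFDerivAt.clm_apply (hasFDerivAt_const p (x t)))
  have h4 := DFunLike.congr_fun (DFunLike.congr_fun (h3.unique h2) w) (deriv x t)
  simp [hSB] at h4
  have h5 := hgeo w
  rw [hsymm, ← hp] at h4
  simp only [add_apply]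
  linarith

/-- The cometric `ξ ↦ ∑ ξ(Vᵢ) Wᵢ` of the tensor `∑ Vᵢ ⊗ Wᵢ`. -/
noncomputable def cometric {ι : Type*} (s : Finset ι) (V W : ι → F) : (F →L[ℝ] ℝ) →L[ℝ] F :=
  ∑ i ∈ s, (NormedSpace.inclusionInDoubleDual ℝ F (V i)).smulRight (W i)

theorem cometric_apply {ι : Type*} (s : Finset ι) (V W : ι → F) (ξ : F →L[ℝ] ℝ) :
    cometric s V W ξ = ∑ i ∈ s, ξ (V i) • W i := by
  simp [cometric]

theorem contDiffAt_cometric {ι : Type*} {s : Finset ι} {V W : ι → F → F} {y : F} {n : ℕ∞ω}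
    (hV : ∀ i ∈ s, ContDiffAt ℝ n (V i) y) (hW : ∀ i ∈ s, ContDiffAt ℝ n (W i) y) :
    ContDiffAt ℝ n (fun z => cometric s (fun i => V i z) (fun i => W i z)) y := by
  unfold cometric
  refine ContDiffAt.sum fun i hi => ?_
  exact (((NormedSpace.inclusionInDoubleDual ℝ F).contDiff.contDiffAt.comp y
    (hV i hi))).smulRight (hW i hi)

theorem fderiv_cometric_apply {ι : Type*} {s : Finset ι} {V W : ι → F → F} {y : F}
    (hV : ∀ i ∈ s, ContDiffAt ℝ 1 (V i) y) (hW : ∀ i ∈ s, ContDiffAt ℝ 1 (W i) y)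
    (ξ : F →L[ℝ] ℝ) (w : F) :
    fderiv ℝ (fun z => cometric s (fun i => V i z) (fun i => W i z)) y w ξ
      = ∑ i ∈ s, (ξ (fderiv ℝ (V i) y w) • W i y + ξ (V i y) • fderiv ℝ (W i) y w) := by
  have h1 := ((contDiffAt_cometric hV hW).differentiableAt one_ne_zero).hasFDerivAt.clm_apply
    (hasFDerivAt_const ξ y)
  simp only [cometric_apply] at h1
  have h2 := HasFDerivAt.fun_sum fun i hi =>
    (ξ.hasFDerivAt.comp y ((hV i hi).differentiableAt one_ne_zero).hasFDerivAt).smul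
      ((hW i hi).differentiableAt one_ne_zero).hasFDerivAt
  have h3 := DFunLike.congr_fun (h1.unique h2) w
  simpa [add_comm] using h3

/-- The bracket `[V, P w]` of a vector field `V` with the field `P w`, `w` a constant vector,
as a linear function of `w`. -/
noncomputable def bracketProj (P : F → F →L[ℝ] F) (V : F → F) (y : F) : F →L[ℝ] F :=
  fderiv ℝ P y (V y) - (fderiv ℝ V y).comp (P y)

theorem continuousAt_bracketProj {P : F → F →L[ℝ] F} {V : F → F} {y : F}
    (hP : ContDiffAt ℝ 1 P y) (hV : ContDiffAt ℝ 1 V y) :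
    ContinuousAt (bracketProj P V) y :=
  ((hP.continuousAt_fderiv one_ne_zero).clm_apply hV.continuousAt).sub
    ((hV.continuousAt_fderiv one_ne_zero).clm_comp hP.continuousAt)

/-- The coefficient of the linear differential equation satisfied by the restriction `p ∘ P` of
the momentum `p` of a geodesic to the distribution onto which `P` projects. -/
noncomputable def momentumCoeff {ι : Type*} (s : Finset ι) (V W : ι → F → F)
    (P : F → F →L[ℝ] F) (y : F) (p : F →L[ℝ] ℝ) : (F →L[ℝ] ℝ) →L[ℝ] (F →L[ℝ] ℝ) :=
  (1 / 2 : ℝ) • ∑ i ∈ s,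
    (p (V i y) • (ContinuousLinearMap.compL ℝ F F ℝ).flip (bracketProj P (W i) y)
      + p (W i y) • (ContinuousLinearMap.compL ℝ F F ℝ).flip (bracketProj P (V i) y))

/-- The equation of motion of `p ∘ P`, for a solution `x`, `p` of Hamilton's equations of the
cometric `∑ Vᵢ ⊗ Wᵢ`: it is linear because the brackets `[Vᵢ, P w]` and `[Wᵢ, P w]` lie in the image
of `P`, so that `p` and `p ∘ P` agree on them. -/
theorem hasDerivAt_momentum_proj {ι : Type*} {s : Finset ι} {V W : ι → F → F}
    {P : F → F →L[ℝ] F} {x : ℝ → F} {p : ℝ → F →L[ℝ] ℝ} {p' : F →L[ℝ] ℝ} {t : ℝ}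
    (hP : DifferentiableAt ℝ P (x t))
    (hx : HasDerivAt x (deriv x t) t)
    (hxV : deriv x t = ∑ i ∈ s, p t (V i (x t)) • W i (x t))
    (hxW : deriv x t = ∑ i ∈ s, p t (W i (x t)) • V i (x t))
    (hp : HasDerivAt p p' t)
    (hp' : ∀ w, p' w = -(1 / 2) * ∑ i ∈ s,
      (p t (fderiv ℝ (V i) (x t) w) * p t (W i (x t))
        + p t (V i (x t)) * p t (fderiv ℝ (W i) (x t) w)))
    (hbV : ∀ i ∈ s, ∀ w, P (x t) (bracketProj P (V i) (x t) w) = bracketProj P (V i) (x t) w)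
    (hbW : ∀ i ∈ s, ∀ w, P (x t) (bracketProj P (W i) (x t) w) = bracketProj P (W i) (x t) w) :
    HasDerivAt (fun s => (p s).comp (P (x s)))
      (momentumCoeff s V W P (x t) (p t) ((p t).comp (P (x t)))) t := by
  have h1 : HasDerivAt (fun s => P (x s)) (fderiv ℝ P (x t) (deriv x t)) t :=
    hP.hasFDerivAt.comp_hasDerivAt t hx
  refine (hp.clm_comp h1).congr_deriv ?_
  ext w
  have h2 : p t (fderiv ℝ P (x t) (deriv x t) w) = (1 / 2) * ∑ i ∈ s,
      (p t (V i (x t)) * p t (fderiv ℝ P (x t) (W i (x t)) w)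
        + p t (W i (x t)) * p t (fderiv ℝ P (x t) (V i (x t)) w)) := by
    have e1 : p t (fderiv ℝ P (x t) (deriv x t) w) =
        ∑ i ∈ s, p t (V i (x t)) * p t (fderiv ℝ P (x t) (W i (x t)) w) := by
      rw [hxV]; simp
    have e2 : p t (fderiv ℝ P (x t) (deriv x t) w) =
        ∑ i ∈ s, p t (W i (x t)) * p t (fderiv ℝ P (x t) (V i (x t)) w) := by
      rw [hxW]; simp
    rw [Finset.sum_add_distrib]
    linarith
  simp only [momentumCoeff, add_apply, ContinuousLinearMap.comp_apply,
    smul_apply, sum_apply, hp', h2,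
    ContinuousLinearMap.flip_apply, ContinuousLinearMap.compL_apply, smul_eq_mul]
  rw [neg_mul, ← mul_neg, ← Finset.sum_neg_distrib, ← mul_add, ← Finset.sum_add_distrib]
  congr 1
  refine Finset.sum_congr rfl fun i hi => ?_
  rw [hbV i hi, hbW i hi]
  simp only [bracketProj, sub_apply, ContinuousLinearMap.comp_apply, map_sub]
  ring

end Momentum

/-! ### Projections onto the kernel of a derivative -/

section Kernel

variable {F K : Type*} [NormedAddCommGroup F] [NormedSpace ℝ F]
  [NormedAddCommGroup K] [NormedSpace ℝ K] [FiniteDimensional ℝ K]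

/-- The kernel of a family of surjective linear maps is the image of a smooth family of
projections. -/
theorem exists_proj_ker {D : F → F →L[ℝ] K} {y₀ : F} {n : ℕ∞ω} (hD : ContDiffAt ℝ n D y₀)
    (hs : Function.Surjective (D y₀)) :
    ∃ P : F → F →L[ℝ] F, ContDiffAt ℝ n P y₀ ∧
      ∀ᶠ y in 𝓝 y₀, (∀ w, D y (P y w) = 0) ∧ ∀ u, D y u = 0 → P y u = u := by
  have : CompleteSpace K := FiniteDimensional.complete ℝ K
  obtain ⟨R', hR'⟩ := (D y₀).toLinearMap.exists_rightInverse_of_surjective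
    (LinearMap.range_eq_top.2 hs)
  let R : K →L[ℝ] F := LinearMap.toContinuousLinearMap R'
  have hR : (D y₀).comp R = ContinuousLinearEquiv.refl ℝ K := by
    ext k
    exact DFunLike.congr_fun hR' k
  have hDR : ContDiffAt ℝ n (fun y => (D y).comp R) y₀ := hD.clm_comp contDiffAt_const
  have hinv : ContDiffAt ℝ n (fun y => ((D y).comp R).inverse) y₀ := by
    refine ContDiffAt.comp y₀ (g := ContinuousLinearMap.inverse) ?_ hDR
    rw [hR]
    exact contDiffAt_map_inverse _
  -- if `R` is a right inverse of `D y₀`, then `R (D y R)⁻¹` is a right inverse of `D y`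
  refine ⟨fun y => ContinuousLinearMap.id ℝ F - R.comp (((D y).comp R).inverse.comp (D y)),
    contDiffAt_const.sub (contDiffAt_const.clm_comp (hinv.clm_comp hD)), ?_⟩
  have hmem : Set.range ((↑) : (K ≃L[ℝ] K) → K →L[ℝ] K) ∈ 𝓝 ((D y₀).comp R) := by
    rw [hR]
    exact ContinuousLinearEquiv.nhds _
  filter_upwards [hDR.continuousAt.preimage_mem_nhds hmem] with y hy
  obtain ⟨e, he⟩ := hy
  constructor
  · intro w
    have h1 : ((D y).comp R) (((D y).comp R).inverse (D y w)) = D y w := by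
      simp only [← he]
      simp
    simpa [sub_eq_zero] using h1.symm
  · intro u hu
    simp [hu]

end Kernel

/-! ### Infinitesimal invariance of a distribution -/

section Invariance

variable {E F K : Type*} [NormedAddCommGroup E] [NormedSpace ℝ E]
  [NormedAddCommGroup F] [NormedSpace ℝ F] [NormedAddCommGroup K] [NormedSpace ℝ K]

/-- If the local transformations `Φ(e, ·)`, with `Φ(e₀, ·) = id`, preserve the distribution
`ker D`, then the Lie derivative of `D` along the generator `z ↦ ∂ₑΦ(e₀, z) a` vanishes on
`ker D`. -/
theorem lie_derivative_eq_zero {Φ : E × F → F} {D : F → F →L[ℝ] K} {e₀ a : E} {y u : F}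
    (hΦ : ContDiffAt ℝ 2 Φ (e₀, y)) (hid : ∀ᶠ z in 𝓝 y, Φ (e₀, z) = z)
    (hD : DifferentiableAt ℝ D y)
    (hinv : ∀ᶠ e in 𝓝 e₀, D (Φ (e, y)) (fderiv ℝ Φ (e, y) (0, u)) = 0) :
    fderiv ℝ D y (fderiv ℝ Φ (e₀, y) (a, 0)) u
      + D y (fderiv ℝ (fun z => fderiv ℝ Φ (e₀, z) (a, 0)) y u) = 0 := by
  have hy : Φ (e₀, y) = y := hid.self_of_nhds
  have hΦ1 : HasFDerivAt Φ (fderiv ℝ Φ (e₀, y)) (e₀, y) :=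
    (hΦ.differentiableAt two_ne_zero).hasFDerivAt
  have hΦ2 : HasFDerivAt (fderiv ℝ Φ) (fderiv ℝ (fderiv ℝ Φ) (e₀, y)) (e₀, y) :=
    ((hΦ.fderiv_right (m := 1) (by norm_num)).differentiableAt one_ne_zero).hasFDerivAt
  have hl : HasFDerivAt (fun e : E => (e, y)) (ContinuousLinearMap.inl ℝ E F) e₀ :=
    hasFDerivAt_prodMk_left e₀ y
  have hr : HasFDerivAt (fun z : F => (e₀, z)) (ContinuousLinearMap.inr ℝ E F) y :=
    hasFDerivAt_prodMk_right e₀ y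
  have hD' : HasFDerivAt D (fderiv ℝ D y) (Φ (e₀, y)) := by rw [hy]; exact hD.hasFDerivAt
  -- `∂_y Φ(e₀, y)` is the identity
  have h1 : fderiv ℝ Φ (e₀, y) (0, u) = u := by
    have h := (hΦ1.comp y hr).unique
      ((hasFDerivAt_id y).congr_of_eventuallyEq (hid.mono fun z hz => hz))
    simpa using DFunLike.congr_fun h u
  have h2 : fderiv ℝ (fun z => fderiv ℝ Φ (e₀, z) (a, 0)) y u
      = fderiv ℝ (fderiv ℝ Φ) (e₀, y) (a, 0) (0, u) := by
    have h := (hΦ2.comp y hr).clm_apply (hasFDerivAt_const ((a, 0) : E × F) y)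
    have h' : fderiv ℝ (fun z => fderiv ℝ Φ (e₀, z) (a, 0)) y = _ := h.fderiv
    -- `∂_u V` is a mixed second derivative of `Φ`
    rw [h', (hΦ.isSymmSndFDerivAt (by simp)).eq]
    simp
  -- differentiate the invariance `D(Φ(e, y)) (∂_y Φ(e, y) u) = 0` in `e`
  have h3 := ((hD'.comp e₀ (hΦ1.comp e₀ hl)).clm_apply
    ((hΦ2.comp e₀ hl).clm_apply (hasFDerivAt_const ((0, u) : E × F) e₀))).unique
    ((hasFDerivAt_const (0 : K) e₀).congr_of_eventuallyEq hinv)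
  have h4 := DFunLike.congr_fun h3 a
  simp [hy, h1] at h4
  rw [h2, add_comm]
  exact h4

/-- If the Lie derivative of `D` along `V` vanishes on `ker D`, then `[V, X]` lies in `ker D` for
all sections `X` of `ker D` of the form `P w`. -/
theorem apply_bracketProj_eq_zero {D : F → F →L[ℝ] K} {P : F → F →L[ℝ] F} {V : F → F} {y w : F}
    (hD : DifferentiableAt ℝ D y) (hP : DifferentiableAt ℝ P y)
    (hDP : ∀ᶠ z in 𝓝 y, D z (P z w) = 0)
    (hV : ∀ u, D y u = 0 → fderiv ℝ D y (V y) u + D y (fderiv ℝ V y u) = 0) :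
    D y (bracketProj P V y w) = 0 := by
  have h1 := (hD.hasFDerivAt.clm_apply (hP.hasFDerivAt.clm_apply (hasFDerivAt_const w y))).unique
    ((hasFDerivAt_const (0 : K) y).congr_of_eventuallyEq hDP)
  have h2 := DFunLike.congr_fun h1 (V y)
  have h3 := hV _ hDP.self_of_nhds
  simp at h2
  simp only [bracketProj, sub_apply, ContinuousLinearMap.comp_apply, map_sub]
  rw [eq_neg_of_add_eq_zero_left h2, eq_neg_of_add_eq_zero_right h3, sub_self]

end Invariance

/-! ### Geodesics in a chart -/

section Chart

variable {F K : Type*} [NormedAddCommGroup F] [NormedSpace ℝ F] [FiniteDimensional ℝ F]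
  [NormedAddCommGroup K] [NormedSpace ℝ K] [FiniteDimensional ℝ K]

/-- In a chart: near each of its points, a geodesic is everywhere or nowhere perpendicular to
`ker D`, if the vector fields `Vᵢ` and `Wᵢ` that define the cometric preserve `ker D`. -/
theorem exists_nhds_forall_perp_ker {ι : Type*} {s : Finset ι} {V W : ι → F → F}
    {D : F → F →L[ℝ] K} {m : F → F → F → ℝ} {x : ℝ → F} {t₁ : ℝ}
    (hV : ∀ i ∈ s, ContDiffAt ℝ 1 (V i) (x t₁)) (hW : ∀ i ∈ s, ContDiffAt ℝ 1 (W i) (x t₁))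
    (hD : ContDiffAt ℝ 1 D (x t₁)) (hDs : Function.Surjective (D (x t₁)))
    (hx : ContDiffAt ℝ 2 x t₁)
    (hsymm : ∀ᶠ y in 𝓝 (x t₁), ∀ ξ,
      cometric s (fun i => V i y) (fun i => W i y) ξ
        = cometric s (fun i => W i y) (fun i => V i y) ξ)
    (hbij : Function.Bijective (cometric s (fun i => V i (x t₁)) (fun i => W i (x t₁))))
    (hm : ∀ᶠ y in 𝓝 (x t₁),
      Function.Bijective (cometric s (fun i => V i y) (fun i => W i y)) →
        ∀ ξ v, m y (cometric s (fun i => V i y) (fun i => W i y) ξ) v = ξ v)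
    (hVD : ∀ i ∈ s, ∀ᶠ y in 𝓝 (x t₁), ∀ u, D y u = 0 →
      fderiv ℝ D y (V i y) u + D y (fderiv ℝ (V i) y u) = 0)
    (hWD : ∀ i ∈ s, ∀ᶠ y in 𝓝 (x t₁), ∀ u, D y u = 0 →
      fderiv ℝ D y (W i y) u + D y (fderiv ℝ (W i) y u) = 0)
    (hgeo : ∀ᶠ t in 𝓝 t₁, ∀ w, m (x t) (deriv (deriv x) t) w
      + (fderiv ℝ (fun z => m z (deriv x t) w) (x t) (deriv x t)
        + fderiv ℝ (fun z => m z (deriv x t) w) (x t) (deriv x t)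
        - fderiv ℝ (fun z => m z (deriv x t) (deriv x t)) (x t) w) / 2 = 0) :
    ∃ N ∈ 𝓝 t₁, ∀ r ∈ N, ∀ t ∈ N, (∀ u, D (x r) u = 0 → m (x r) (deriv x r) u = 0) →
      ∀ u, D (x t) u = 0 → m (x t) (deriv x t) u = 0 := by
  set S : F → (F →L[ℝ] ℝ) →L[ℝ] F :=
    fun y => cometric s (fun i => V i y) (fun i => W i y) with hSdef
  set y₁ := x t₁ with hy₁
  obtain ⟨P, hP, hPD⟩ := exists_proj_ker hD hDs
  have hS : ContDiffAt ℝ 1 S y₁ := contDiffAt_cometric hV hW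
  let e : (F →L[ℝ] ℝ) ≃L[ℝ] F :=
    (LinearEquiv.ofBijective (S y₁).toLinearMap hbij).toContinuousLinearEquiv
  have he : (e : (F →L[ℝ] ℝ) →L[ℝ] F) = S y₁ := by ext; rfl
  let B : F → F →L[ℝ] F →L[ℝ] ℝ := fun y => (S y).inverse
  have hB : ContDiffAt ℝ 1 B y₁ := by
    refine ContDiffAt.comp y₁ (g := ContinuousLinearMap.inverse) ?_ hS
    rw [← he]
    exact contDiffAt_map_inverse _
  -- near `y₁`, the metric `m` is the inverse `B` of the cometric `S`
  have hinv : ∀ᶠ y in 𝓝 y₁, (∀ ξ, B y (S y ξ) = ξ) ∧ (∀ v, S y (B y v) = v) ∧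
      ∀ u v, m y u v = B y u v := by
    have hmem : Set.range ((↑) : ((F →L[ℝ] ℝ) ≃L[ℝ] F) → (F →L[ℝ] ℝ) →L[ℝ] F) ∈ 𝓝 (S y₁) := by
      rw [← he]
      exact ContinuousLinearEquiv.nhds _
    filter_upwards [hS.continuousAt.preimage_mem_nhds hmem, hm] with y hy hmy
    obtain ⟨f, hf⟩ := hy
    have h2 : ∀ v, S y (B y v) = v := fun v => by simp [B, ← hf]
    refine ⟨fun ξ => by simp [B, ← hf], h2, fun u v => ?_⟩
    have h3 : m y (S y (B y u)) v = B y u v :=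
      hmy (by change Function.Bijective (S y); rw [← hf]; exact f.bijective) (B y u) v
    rwa [h2] at h3
  have hBsymm : ∀ᶠ y in 𝓝 y₁, ∀ u v, B y u v = B y v u := by
    filter_upwards [hinv, hsymm] with y hy hys u v
    have h1 : B y v (S y (B y u)) = B y u (S y (B y v)) := by
      conv_rhs => rw [hSdef]; beta_reduce; rw [hys]
      simp only [hSdef, cometric_apply, map_sum, map_smul, smul_eq_mul]
      exact Finset.sum_congr rfl fun i _ => mul_comm _ _
    rw [hy.2.1, hy.2.1] at h1
    exact h1.symm
  have hxc : Tendsto x (𝓝 t₁) (𝓝 y₁) := hx.continuousAt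
  have hx' : ContDiffAt ℝ 1 (deriv x) t₁ := by
    have h := hx.fderiv_right (m := 1) (by norm_num)
    exact h.clm_apply contDiffAt_const
  have hBx : ContinuousAt (fun t => B (x t) (deriv x t)) t₁ :=
    (ContinuousAt.comp (g := B) hB.continuousAt hxc).clm_apply hx'.continuousAt
  -- Hamilton's equations, projected to `ker D`
  have hode : ∀ᶠ t in 𝓝 t₁, HasDerivAt (fun t => (B (x t) (deriv x t)).comp (P (x t)))
      (momentumCoeff s V W P (x t) (B (x t) (deriv x t))
        ((B (x t) (deriv x t)).comp (P (x t)))) t := by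
    have hVe : ∀ᶠ y in 𝓝 y₁, ∀ i ∈ s, ContDiffAt ℝ 1 (V i) y ∧ ContDiffAt ℝ 1 (W i) y ∧
        (∀ u, D y u = 0 → fderiv ℝ D y (V i y) u + D y (fderiv ℝ (V i) y u) = 0) ∧
        (∀ u, D y u = 0 → fderiv ℝ D y (W i y) u + D y (fderiv ℝ (W i) y u) = 0) :=
      (s.eventually_all).2 fun i hi => ((hV i hi).eventually (by simp)).and
        (((hW i hi).eventually (by simp)).and ((hVD i hi).and (hWD i hi)))
    have hall := hVe.and (hinv.eventually_nhds.and (hBsymm.and (hPD.eventually_nhds.and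
      (hsymm.and ((hB.eventually (by simp)).and ((hP.eventually (by simp)).and
        (hD.eventually (by simp))))))))
    filter_upwards [hxc.eventually hall, hx.eventually (by simp), hx'.eventually (by simp), hgeo]
      with t ⟨hVt, hinvt, hBsymmt, hPDt, hsymmt, hBt, hPt, hDt⟩ hxt hxt' hgeot
    have hVW : ∀ i ∈ s, ContDiffAt ℝ 1 (V i) (x t) := fun i hi => (hVt i hi).1
    have hWW : ∀ i ∈ s, ContDiffAt ℝ 1 (W i) (x t) := fun i hi => (hVt i hi).2.1
    have hxd := (hxt.differentiableAt two_ne_zero).hasDerivAt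
    have hinv0 := hinvt.self_of_nhds
    have hBd := hBt.differentiableAt one_ne_zero
    have hfd : ∀ u v w, fderiv ℝ (fun z => m z u v) (x t) w = fderiv ℝ B (x t) w u v := by
      intro u v w
      have h1 : (fun z => m z u v) =ᶠ[𝓝 (x t)] fun z => B z u v := hinvt.mono fun z hz => hz.2.2 u v
      rw [h1.fderiv_eq]
      have h2 := (hBd.hasFDerivAt.clm_apply (hasFDerivAt_const u (x t))).clm_apply
        (hasFDerivAt_const v (x t))
      rw [h2.fderiv]
      simp
    obtain ⟨p', hp', hp'w⟩ := hasDerivAt_momentum hxd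
      (hxt'.differentiableAt one_ne_zero).hasDerivAt hBd
      ((contDiffAt_cometric hVW hWW).differentiableAt one_ne_zero)
      (hinvt.mono fun z hz => hz.1) (hinv0.2.1 _) hBsymmt
      (fun w => by
        have h := hgeot w
        rwa [hinv0.2.2, hfd, hfd] at h)
    have hbr : ∀ X : F → F,
        (∀ u, D (x t) u = 0 → fderiv ℝ D (x t) (X (x t)) u + D (x t) (fderiv ℝ X (x t) u) = 0) →
        ∀ w, P (x t) (bracketProj P X (x t) w) = bracketProj P X (x t) w := fun X h w =>
      hPDt.self_of_nhds.2 _ (apply_bracketProj_eq_zero (hDt.differentiableAt one_ne_zero)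
        (hPt.differentiableAt one_ne_zero) (hPDt.mono fun z hz => hz.1 w) h)
    refine hasDerivAt_momentum_proj (hPt.differentiableAt one_ne_zero) hxd ?_ ?_ hp' ?_
      (fun i hi => hbr _ (hVt i hi).2.2.1)
      (fun i hi => hbr _ (hVt i hi).2.2.2)
    · conv_lhs => rw [← hinv0.2.1 (deriv x t)]
      exact cometric_apply _ _ _ _
    · conv_lhs => rw [← hinv0.2.1 (deriv x t)]
      exact (hsymmt _).trans (cometric_apply _ _ _ _)
    · intro w
      rw [hp'w, fderiv_cometric_apply hVW hWW]
      simp only [map_sum, map_add, map_smul, smul_eq_mul]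
  have hA : ContinuousAt (fun t => momentumCoeff s V W P (x t) (B (x t) (deriv x t))) t₁ := by
    have hc : ∀ X : F → F, ContDiffAt ℝ 1 X y₁ →
        ContinuousAt (fun t => B (x t) (deriv x t) (X (x t))) t₁ := fun X h =>
      hBx.clm_apply (ContinuousAt.comp (g := X) h.continuousAt hxc)
    have hN : ∀ X : F → F, ContDiffAt ℝ 1 X y₁ → ContinuousAt (fun t =>
        (ContinuousLinearMap.compL ℝ F F ℝ).flip (bracketProj P X (x t))) t₁ := fun X h =>
      ((ContinuousLinearMap.compL ℝ F F ℝ).flip.continuous.continuousAt).comp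
        (ContinuousAt.comp (g := bracketProj P X) (continuousAt_bracketProj hP h) hxc)
    unfold momentumCoeff
    exact (tendsto_finsetSum _ fun i hi => ((hc _ (hV i hi)).smul (hN _ (hW i hi))).add
      ((hc _ (hW i hi)).smul (hN _ (hV i hi)))).const_smul _
  obtain ⟨N, hN, hN0⟩ := exists_nhds_forall_eq_zero_of_linear_ode hA hode
  obtain ⟨N', hN', hgood⟩ := (hxc.eventually (hinv.and hPD)).exists_mem
  refine ⟨N ∩ N', inter_mem hN hN', fun r hr t ht h u hu => ?_⟩
  have h0 := hN0 r hr.1 t ht.1 (by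
    ext w
    have h1 := h (P (x r) w) ((hgood r hr.2).2.1 w)
    rwa [(hgood r hr.2).1.2.2] at h1)
  have h2 := DFunLike.congr_fun h0 u
  rw [(hgood t ht.2).1.2.2]
  rwa [ContinuousLinearMap.comp_apply, (hgood t ht.2).2.2 u hu] at h2

end Chart

/-! ### Smoothness of the action on the coset space -/

section Section

variable {E F : Type*} [NormedAddCommGroup E] [NormedSpace ℝ E]
  [NormedAddCommGroup F] [NormedSpace ℝ F]
  {M : Type*} [TopologicalSpace M] [ChartedSpace E M]
  {N : Type*} [TopologicalSpace N] [ChartedSpace F N]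

/-- A submersion has a smooth local section through every point of its domain. -/
theorem exists_contMDiffAt_section {f : M → N} {x : M}
    (h : Manifold.IsSubmersionAt 𝓘(ℝ, E) 𝓘(ℝ, F) ∞ f x) :
    ∃ σ : N → M, ContMDiffAt 𝓘(ℝ, F) 𝓘(ℝ, E) ∞ σ (f x) ∧ σ (f x) = x ∧
      ∀ᶠ y in 𝓝 (f x), f (σ y) = y := by
  have hw : ∀ z ∈ h.domChart.target, h.codChart (f (h.domChart.symm z)) = (h.equiv z).1 := by
    intro z hz
    have hz' : z ∈ (h.domChart.extend 𝓘(ℝ, E)).target := by simpa using hz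
    simpa using h.writtenInCharts hz'
  have hx := h.mem_domChart_source
  have hfx := h.mem_codChart_source
  set k := (h.equiv (h.domChart x)).2
  set τ : N → E := fun y => h.equiv.symm (h.codChart y, k) with hτ
  have hτx : τ (f x) = h.domChart x := by
    have h1 := hw _ (h.domChart.map_source hx)
    rw [h.domChart.left_inv hx] at h1
    simp [hτ, h1, k]
  have hτs : ContMDiffAt 𝓘(ℝ, F) 𝓘(ℝ, E) ∞ τ (f x) := by
    have h1 : ContMDiffAt 𝓘(ℝ, F) 𝓘(ℝ, F) ∞ h.codChart (f x) :=
      contMDiffAt_of_mem_maximalAtlas h.codChart_mem_maximalAtlas hfx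
    have h2 : ContDiff ℝ ∞ (fun z : F => h.equiv.symm (z, k)) :=
      h.equiv.symm.contDiff.comp (contDiff_id.prodMk contDiff_const)
    exact h2.contMDiff.contMDiffAt.comp (f x) h1
  have hτt : ∀ᶠ y in 𝓝 (f x), τ y ∈ h.domChart.target :=
    hτs.continuousAt.eventually (by
      rw [hτx]; exact h.domChart.open_target.mem_nhds (h.domChart.map_source hx))
  refine ⟨fun y => h.domChart.symm (τ y), ?_, by simp [hτx, h.domChart.left_inv hx], ?_⟩
  · have h1 : ContMDiffAt 𝓘(ℝ, E) 𝓘(ℝ, E) ∞ h.domChart.symm (τ (f x)) :=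
      (contMDiffOn_symm_of_mem_maximalAtlas h.domChart_mem_maximalAtlas).contMDiffAt
        (h.domChart.open_target.mem_nhds hτt.self_of_nhds)
    exact h1.comp (f x) hτs
  · filter_upwards [hτt, h.codChart.open_source.mem_nhds hfx] with y hy hys
    refine h.codChart.injOn (h.source_subset_preimage_source (h.domChart.map_target hy)) hys ?_
    rw [hw _ hy]
    simp [hτ]

end Section

section Action

theorem translate_one {G : Type*} [Group G] (H : Subgroup G) (p : RightCosetSpace H) :
    translate H 1 p = p := by
  obtain ⟨x, rfl⟩ := Quotient.exists_rep p
  exact congrArg (proj H) (mul_one x)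

variable {E F G : Type*} [NormedAddCommGroup E] [NormedSpace ℝ E]
  [NormedAddCommGroup F] [NormedSpace ℝ F]
  [TopologicalSpace G] [ChartedSpace E G] [Group G] [LieGroup 𝓘(ℝ, E) ∞ G]
  {H : Subgroup G} [ChartedSpace F (RightCosetSpace H)]

/-- The action of `G` on `H \ G` is smooth: with a local section `σ` of the projection, `p g` is the
projection of `σ(p) g`. -/
theorem contMDiff_translate (hπ : IsQuotientManifold E F H) :
    ContMDiff (𝓘(ℝ, E).prod 𝓘(ℝ, F)) 𝓘(ℝ, F) ∞
      (fun z : G × RightCosetSpace H => translate H z.1 z.2) := by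
  rintro ⟨g, p⟩
  obtain ⟨x, rfl⟩ := Quotient.exists_rep p
  obtain ⟨σ, hσ, hσx, hσ'⟩ := exists_contMDiffAt_section (hπ.isSubmersionAt x)
  have h1 : ContMDiffAt (𝓘(ℝ, E).prod 𝓘(ℝ, F)) 𝓘(ℝ, E) ∞
      (fun z : G × RightCosetSpace H => σ z.2 * z.1) (g, proj H x) :=
    ContMDiffAt.mul (ContMDiffAt.comp (g, proj H x) hσ contMDiffAt_snd) contMDiffAt_fst
  refine (hπ.contMDiff.contMDiffAt.comp (g, proj H x) h1).congr_of_eventuallyEq ?_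
  have h2 : ∀ᶠ z : G × RightCosetSpace H in 𝓝 (g, proj H x), proj H (σ z.2) = z.2 :=
    (continuous_snd.tendsto (g, proj H x)).eventually hσ'
  filter_upwards [h2] with z hz
  conv_lhs => rw [← hz]
  exact translate_proj H _ _

end Action

/-! ### The metric in a chart -/

section Sharp

variable {E F G : Type*} [NormedAddCommGroup E] [NormedSpace ℝ E]
  [NormedAddCommGroup F] [NormedSpace ℝ F]
  [TopologicalSpace G] [ChartedSpace E G] [Group G]
  {H : Subgroup G} [ChartedSpace F (RightCosetSpace H)]

theorem sharp_sum {ι : Type*} (s : Finset ι) (a b : ι → GroupLieAlgebra 𝓘(ℝ, E) G)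
    (p : RightCosetSpace H) (ξ : Module.Dual ℝ (TangentSpace 𝓘(ℝ, F) p)) :
    sharp (∑ i ∈ s, a i ⊗ₜ[ℝ] b i) p ξ
      = ∑ i ∈ s, ξ (generator F p (a i)) • generator F p (b i) := by
  simp [sharp, tensorField]

theorem metric_sharp {C : GroupLieAlgebra 𝓘(ℝ, E) G ⊗[ℝ] GroupLieAlgebra 𝓘(ℝ, E) G}
    {p : RightCosetSpace H} (h : Function.Bijective (sharp (F := F) C p))
    (ξ : Module.Dual ℝ (TangentSpace 𝓘(ℝ, F) p)) :
    metric F H C p (sharp C p ξ) = ξ := by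
  rw [metric, dif_pos h]
  exact (LinearEquiv.ofBijective (sharp (F := F) C p) h).symm_apply_apply ξ

/-- The coordinate expression in the chart `c` of the vector field by which `a` acts. -/
noncomputable def generatorInChart (c : OpenPartialHomeomorph (RightCosetSpace H) F)
    (a : GroupLieAlgebra 𝓘(ℝ, E) G) (y : F) : F :=
  mfderiv 𝓘(ℝ, F) 𝓘(ℝ, F) c (c.symm y) (generator F (c.symm y) a)

variable {c : OpenPartialHomeomorph (RightCosetSpace H) F}

/-- In the chart `c`, the operator `sharp` becomes the cometric of the generating fields. -/
theorem cometric_generatorInChart {ι : Type*} (s : Finset ι)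
    (a b : ι → GroupLieAlgebra 𝓘(ℝ, E) G) (y : F) (η : F →L[ℝ] ℝ) :
    cometric s (fun i => generatorInChart c (a i) y) (fun i => generatorInChart c (b i) y) η
      = mfderiv 𝓘(ℝ, F) 𝓘(ℝ, F) c (c.symm y) (sharp (∑ i ∈ s, a i ⊗ₜ[ℝ] b i) (c.symm y)
          (η.toLinearMap ∘ₗ (mfderiv 𝓘(ℝ, F) 𝓘(ℝ, F) c (c.symm y)).toLinearMap)) := by
  rw [sharp_sum, cometric_apply, map_sum]
  refine Finset.sum_congr rfl fun i _ => ?_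
  rw [map_smul]
  rfl

/-- Perpendicularity, in the chart `c`. The point `p = c.symm y` is a variable so that the lemma
applies to points that are not literally of the form `c.symm y`. -/
theorem mem_perp_iff (hc : c.MDifferentiable 𝓘(ℝ, F) 𝓘(ℝ, F)) {y : F} (hy : y ∈ c.target)
    {p : RightCosetSpace H} (hp : c.symm y = p) (g : BilinField F (RightCosetSpace H))
    (Λ : Distribution F (RightCosetSpace H)) (v : TangentSpace 𝓘(ℝ, F) p) :
    v ∈ perp g Λ p ↔ ∀ u : F, mfderiv 𝓘(ℝ, F) 𝓘(ℝ, F) c.symm y u ∈ Λ (c.symm y) →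
      metricInChart g c y (mfderiv 𝓘(ℝ, F) 𝓘(ℝ, F) c p v) u = 0 := by
  subst hp
  have hT : ∀ u : F, mfderiv 𝓘(ℝ, F) 𝓘(ℝ, F) c (c.symm y)
      (mfderiv 𝓘(ℝ, F) 𝓘(ℝ, F) c.symm y u) = u :=
    fun u => DFunLike.congr_fun (hc.comp_symm_deriv hy) u
  have hT' : ∀ u, mfderiv 𝓘(ℝ, F) 𝓘(ℝ, F) c.symm y
      (mfderiv 𝓘(ℝ, F) 𝓘(ℝ, F) c (c.symm y) u) = u :=
    fun u => (hc.mfderiv_injective (c.map_target hy)) (hT _)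
  constructor
  · intro h u hu
    change g (c.symm y) (mfderiv 𝓘(ℝ, F) 𝓘(ℝ, F) c.symm y
      (mfderiv 𝓘(ℝ, F) 𝓘(ℝ, F) c (c.symm y) v)) (mfderiv 𝓘(ℝ, F) 𝓘(ℝ, F) c.symm y u) = 0
    rw [hT']
    exact h _ hu
  · intro h u hu
    have h1 := h (mfderiv 𝓘(ℝ, F) 𝓘(ℝ, F) c (c.symm y) u) (by rwa [hT'])
    change g (c.symm y) (mfderiv 𝓘(ℝ, F) 𝓘(ℝ, F) c.symm y
      (mfderiv 𝓘(ℝ, F) 𝓘(ℝ, F) c (c.symm y) v)) (mfderiv 𝓘(ℝ, F) 𝓘(ℝ, F) c.symm y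
        (mfderiv 𝓘(ℝ, F) 𝓘(ℝ, F) c (c.symm y) u)) = 0 at h1
    rwa [hT', hT'] at h1

variable [FiniteDimensional ℝ F]

theorem bijective_cometric_iff (hc : c.MDifferentiable 𝓘(ℝ, F) 𝓘(ℝ, F)) {ι : Type*} (s : Finset ι)
    (a b : ι → GroupLieAlgebra 𝓘(ℝ, E) G) {y : F} (hy : y ∈ c.target) :
    Function.Bijective (cometric s (fun i => generatorInChart c (a i) y)
        (fun i => generatorInChart c (b i) y))
      ↔ Function.Bijective (sharp (F := F) (∑ i ∈ s, a i ⊗ₜ[ℝ] b i) (c.symm y)) := by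
  let T : TangentSpace 𝓘(ℝ, F) (c.symm y) ≃ₗ[ℝ] F :=
    (hc.mfderiv (c.map_target hy)).toLinearEquiv
  let T' : (F →L[ℝ] ℝ) ≃ₗ[ℝ] Module.Dual ℝ (TangentSpace 𝓘(ℝ, F) (c.symm y)) :=
    (LinearMap.toContinuousLinearMap (𝕜 := ℝ) (E := F) (F' := ℝ)).symm.trans T.dualMap
  have h : ⇑(cometric s (fun i => generatorInChart c (a i) y)
        (fun i => generatorInChart c (b i) y))
      = T ∘ sharp (F := F) (∑ i ∈ s, a i ⊗ₜ[ℝ] b i) (c.symm y) ∘ T' := by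
    funext η
    exact cometric_generatorInChart s a b y η
  rw [h, T.bijective.of_comp_iff', T'.bijective.of_comp_iff]

/-- In the chart `c`, the metric is the inverse of the cometric, wherever that is invertible. -/
theorem metricInChart_cometric (hc : c.MDifferentiable 𝓘(ℝ, F) 𝓘(ℝ, F)) {ι : Type*} (s : Finset ι)
    (a b : ι → GroupLieAlgebra 𝓘(ℝ, E) G) {y : F} (hy : y ∈ c.target)
    (hb : Function.Bijective (cometric s (fun i => generatorInChart c (a i) y)
        (fun i => generatorInChart c (b i) y))) (η : F →L[ℝ] ℝ) (v : F) :
    metricInChart (metric F H (∑ i ∈ s, a i ⊗ₜ[ℝ] b i)) c y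
      (cometric s (fun i => generatorInChart c (a i) y) (fun i => generatorInChart c (b i) y) η) v
        = η v := by
  let T := hc.mfderiv (c.map_target hy)
  have hT : ∀ u : F, mfderiv 𝓘(ℝ, F) 𝓘(ℝ, F) c (c.symm y)
      (mfderiv 𝓘(ℝ, F) 𝓘(ℝ, F) c.symm y u) = u :=
    fun u => DFunLike.congr_fun (hc.comp_symm_deriv hy) u
  have hT' : ∀ u, mfderiv 𝓘(ℝ, F) 𝓘(ℝ, F) c.symm y
      (mfderiv 𝓘(ℝ, F) 𝓘(ℝ, F) c (c.symm y) u) = u :=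
    fun u => (hc.mfderiv_injective (c.map_target hy)) (hT _)
  have h := metric_sharp ((bijective_cometric_iff hc s a b hy).1 hb)
    (η.toLinearMap ∘ₗ (mfderiv 𝓘(ℝ, F) 𝓘(ℝ, F) c (c.symm y)).toLinearMap)
  rw [metricInChart, cometric_generatorInChart, hT', h]
  exact congrArg η (hT v)

end Sharp

/-! ### Functions in a chart -/

theorem fderiv_comp_symm_apply {F K M : Type*} [NormedAddCommGroup F] [NormedSpace ℝ F]
    [NormedAddCommGroup K] [NormedSpace ℝ K] [TopologicalSpace M] [ChartedSpace F M]
    {c : OpenPartialHomeomorph M F} {f : M → K} {y : F}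
    (hf : MDifferentiableAt 𝓘(ℝ, F) 𝓘(ℝ, K) f (c.symm y))
    (hc : MDifferentiableAt 𝓘(ℝ, F) 𝓘(ℝ, F) c.symm y) (u : F) :
    fderiv ℝ (f ∘ c.symm) y u
      = mfderiv 𝓘(ℝ, F) 𝓘(ℝ, K) f (c.symm y) (mfderiv 𝓘(ℝ, F) 𝓘(ℝ, F) c.symm y u) := by
  have h : HasFDerivAt (f ∘ c.symm)
      ((mfderiv 𝓘(ℝ, F) 𝓘(ℝ, K) f (c.symm y) : F →L[ℝ] K).comp
        (mfderiv 𝓘(ℝ, F) 𝓘(ℝ, F) c.symm y : F →L[ℝ] F)) y :=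
    (HasMFDerivAt.comp y hf.hasMFDerivAt hc.hasMFDerivAt).hasFDerivAt
  -- the identification of tangent spaces with `F` is left to unification with `L`
  have key : ∀ L : F →L[ℝ] K, HasFDerivAt (f ∘ c.symm) L y → fderiv ℝ (f ∘ c.symm) y u = L u :=
    fun L hL => by rw [hL.fderiv]
  exact key _ h

theorem contDiffAt_comp_symm {F K M : Type*} [NormedAddCommGroup F] [NormedSpace ℝ F]
    [NormedAddCommGroup K] [NormedSpace ℝ K] [TopologicalSpace M] [ChartedSpace F M]
    [IsManifold 𝓘(ℝ, F) ∞ M] {c : OpenPartialHomeomorph M F} (hc : c ∈ atlas F M) {f : M → K}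
    {y : F} (hy : y ∈ c.target) (hf : ContMDiffAt 𝓘(ℝ, F) 𝓘(ℝ, K) ∞ f (c.symm y)) :
    ContDiffAt ℝ ∞ (f ∘ c.symm) y := by
  rw [← contMDiffAt_iff_contDiffAt]
  exact hf.comp y ((contMDiffOn_symm_of_mem_maximalAtlas
    (IsManifold.subset_maximalAtlas hc)).contMDiffAt (c.open_target.mem_nhds hy))

/-! ### The action in a chart -/

section ActionInChart

variable {E F G : Type*} [NormedAddCommGroup E] [NormedSpace ℝ E]
  [NormedAddCommGroup F] [NormedSpace ℝ F]
  [TopologicalSpace G] [ChartedSpace E G] [Group G]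
  {H : Subgroup G} [ChartedSpace F (RightCosetSpace H)]

theorem chartAt_symm_chartAt_one (E G : Type*) [TopologicalSpace E] [TopologicalSpace G]
    [ChartedSpace E G] [One G] : (chartAt E (1 : G)).symm (chartAt E (1 : G) 1) = 1 :=
  (chartAt E (1 : G)).left_inv (mem_chart_source E 1)

/-- The action of `G` on `H \ G`, written in the preferred chart of `G` at `1` and in the
chart `c` of `H \ G`. -/
noncomputable def actionInChart (E : Type*) {F G : Type*} [TopologicalSpace E] [TopologicalSpace F]
    [TopologicalSpace G] [ChartedSpace E G] [Group G] {H : Subgroup G}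
    (c : OpenPartialHomeomorph (RightCosetSpace H) F) (z : E × F) : F :=
  c (translate H ((chartAt E (1 : G)).symm z.1) (c.symm z.2))

theorem actionInChart_one {E F G : Type*} [TopologicalSpace E] [TopologicalSpace F]
    [TopologicalSpace G] [ChartedSpace E G] [Group G] {H : Subgroup G}
    {c : OpenPartialHomeomorph (RightCosetSpace H) F} {y : F} (hy : y ∈ c.target) :
    actionInChart E c (chartAt E (1 : G) 1, y) = y := by
  simp [actionInChart, translate_one, c.right_inv hy]

variable {c : OpenPartialHomeomorph (RightCosetSpace H) F}

variable [LieGroup 𝓘(ℝ, E) ∞ G] [IsManifold 𝓘(ℝ, F) ∞ (RightCosetSpace H)]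

theorem contMDiffAt_translate_chart (hπ : IsQuotientManifold E F H)
    (hc : c ∈ atlas F (RightCosetSpace H)) {y : F} (hy : y ∈ c.target) :
    ContMDiffAt 𝓘(ℝ, E × F) 𝓘(ℝ, F) ∞ (fun z : E × F =>
      translate H ((chartAt E (1 : G)).symm z.1) (c.symm z.2)) (chartAt E (1 : G) 1, y) := by
  have h1 : ContMDiffAt 𝓘(ℝ, E × F) 𝓘(ℝ, E) ∞
      (fun z : E × F => (chartAt E (1 : G)).symm z.1) (chartAt E (1 : G) 1, y) := by
    have h : ContMDiffAt 𝓘(ℝ, E) 𝓘(ℝ, E) ∞ (chartAt E (1 : G)).symm (chartAt E (1 : G) 1) :=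
      (contMDiffOn_symm_of_mem_maximalAtlas
        (IsManifold.chart_mem_maximalAtlas (I := 𝓘(ℝ, E)) (n := ∞) (1 : G))).contMDiffAt
        ((chartAt E (1 : G)).open_target.mem_nhds (mem_chart_target E 1))
    exact ContMDiffAt.comp (chartAt E (1 : G) 1, y) h contDiff_fst.contMDiff.contMDiffAt
  have h2 : ContMDiffAt 𝓘(ℝ, E × F) 𝓘(ℝ, F) ∞
      (fun z : E × F => c.symm z.2) (chartAt E (1 : G) 1, y) := by
    have h : ContMDiffAt 𝓘(ℝ, F) 𝓘(ℝ, F) ∞ c.symm y :=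
      (contMDiffOn_symm_of_mem_maximalAtlas
        (IsManifold.subset_maximalAtlas hc)).contMDiffAt (c.open_target.mem_nhds hy)
    exact ContMDiffAt.comp (chartAt E (1 : G) 1, y) h contDiff_snd.contMDiff.contMDiffAt
  exact (contMDiff_translate hπ).contMDiffAt.comp (chartAt E (1 : G) 1, y) (h1.prodMk h2)

theorem contDiffAt_actionInChart (hπ : IsQuotientManifold E F H)
    (hc : c ∈ atlas F (RightCosetSpace H)) {y : F} (hy : y ∈ c.target) :
    ContDiffAt ℝ ∞ (actionInChart E c) (chartAt E (1 : G) 1, y) := by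
  rw [← contMDiffAt_iff_contDiffAt]
  have h : ContMDiffAt 𝓘(ℝ, F) 𝓘(ℝ, F) ∞ c
      (translate H ((chartAt E (1 : G)).symm (chartAt E (1 : G) 1)) (c.symm y)) := by
    rw [chartAt_symm_chartAt_one, translate_one]
    exact contMDiffAt_of_mem_maximalAtlas (IsManifold.subset_maximalAtlas hc) (c.map_target hy)
  exact ContMDiffAt.comp (chartAt E (1 : G) 1, y) h (contMDiffAt_translate_chart hπ hc hy)

/-- The generating fields are partial derivatives of the action, all in charts; hence they are
smooth. -/
theorem generatorInChart_eq_fderiv (hπ : IsQuotientManifold E F H)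
    (hc : c ∈ atlas F (RightCosetSpace H)) {y : F} (hy : y ∈ c.target)
    (a : GroupLieAlgebra 𝓘(ℝ, E) G) :
    generatorInChart c a y
      = fderiv ℝ (actionInChart E c) (chartAt E (1 : G) 1, y) ((a : E), 0) := by
  set e₀ := chartAt E (1 : G) 1 with he₀
  set orb : G → RightCosetSpace H := fun g => translate H g (c.symm y) with horb
  have horb1 : orb 1 = c.symm y := translate_one H _
  have hcd := mdifferentiable_of_mem_atlas (I := 𝓘(ℝ, F)) hc
  -- the derivative of the orbit map at `1`, computed in the chart of `G` at `1`
  have horbd : MDifferentiableAt 𝓘(ℝ, E) 𝓘(ℝ, F) orb 1 := by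
    have h : ContMDiff 𝓘(ℝ, E) 𝓘(ℝ, F) ∞ orb :=
      (contMDiff_translate hπ).comp (contMDiff_id.prodMk contMDiff_const)
    exact h.contMDiffAt.mdifferentiableAt (by simp)
  have hch : HasMFDerivAt 𝓘(ℝ, E) 𝓘(ℝ, E) (chartAt E (1 : G)).symm e₀
      (ContinuousLinearMap.id ℝ E) := by
    have h1 : mfderiv 𝓘(ℝ, E) 𝓘(ℝ, E) (chartAt E (1 : G)).symm e₀ = ContinuousLinearMap.id ℝ E := by
      have h := mfderivWithin_range_extChartAt_symm (I := 𝓘(ℝ, E)) (x := (1 : G))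
      simpa [mfderivWithin_univ] using! h
    have h2 : MDifferentiableAt 𝓘(ℝ, E) 𝓘(ℝ, E) (chartAt E (1 : G)).symm e₀ :=
      mdifferentiableAt_atlas_symm (chart_mem_atlas E 1) (mem_chart_target E 1)
    rw [← h1]
    exact h2.hasMFDerivAt
  have h1 : HasMFDerivAt 𝓘(ℝ, E) 𝓘(ℝ, F) orb ((chartAt E (1 : G)).symm e₀)
      (mfderiv 𝓘(ℝ, E) 𝓘(ℝ, F) orb 1 : E →L[ℝ] F) := by
    rw [he₀, chartAt_symm_chartAt_one]
    exact horbd.hasMFDerivAt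
  have h2 : HasMFDerivAt 𝓘(ℝ, F) 𝓘(ℝ, F) c (orb ((chartAt E (1 : G)).symm e₀))
      (mfderiv 𝓘(ℝ, F) 𝓘(ℝ, F) c (c.symm y) : F →L[ℝ] F) := by
    rw [he₀, chartAt_symm_chartAt_one, horb1]
    exact (hcd.mdifferentiableAt (c.map_target hy)).hasMFDerivAt
  have h3 : HasFDerivAt (fun e => actionInChart E c (e, y))
      ((mfderiv 𝓘(ℝ, F) 𝓘(ℝ, F) c (c.symm y) : F →L[ℝ] F).comp
        (mfderiv 𝓘(ℝ, E) 𝓘(ℝ, F) orb 1 : E →L[ℝ] F)) e₀ :=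
    (HasMFDerivAt.comp e₀ h2 (HasMFDerivAt.comp e₀ h1 hch)).hasFDerivAt
  have h4 := (((contDiffAt_actionInChart (E := E) hπ hc hy).differentiableAt
    (by simp)).hasFDerivAt).comp e₀ (hasFDerivAt_prodMk_left (𝕜 := ℝ) e₀ y)
  have key : ∀ L L' : E →L[ℝ] F, HasFDerivAt (fun e => actionInChart E c (e, y)) L e₀ →
      HasFDerivAt (fun e => actionInChart E c (e, y)) L' e₀ → L a = L' a :=
    fun L L' h h' => by rw [h.unique h']
  exact key _ _ h3 h4

theorem contDiffAt_generatorInChart (hπ : IsQuotientManifold E F H)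
    (hc : c ∈ atlas F (RightCosetSpace H))
    {y : F} (hy : y ∈ c.target) (a : GroupLieAlgebra 𝓘(ℝ, E) G) :
    ContDiffAt ℝ 1 (generatorInChart c a) y := by
  have h1 : ContDiffAt ℝ 1 (fun z => fderiv ℝ (actionInChart E c) (chartAt E (1 : G) 1, z)
      ((a : E), 0)) y :=
    (ContDiffAt.comp y (g := fderiv ℝ (actionInChart E c))
      (f := fun z => (chartAt E (1 : G) 1, z))
      ((contDiffAt_actionInChart hπ hc hy).fderiv_right (by norm_cast))
      (contDiffAt_const.prodMk contDiffAt_id)).clm_apply contDiffAt_const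
  refine h1.congr_of_eventuallyEq ?_
  filter_upwards [c.open_target.mem_nhds hy] with z hz
  exact generatorInChart_eq_fderiv hπ hc hz a

/-- The vector fields by which `𝔤` acts preserve an invariant distribution, in a chart: if the
distribution is given by `D = d(f ∘ c.symm)`, the Lie derivative of `D` along them vanishes on
`ker D`. -/
theorem lie_derivative_generatorInChart {K : Type*} [NormedAddCommGroup K] [NormedSpace ℝ K]
    (hπ : IsQuotientManifold E F H)
    (hc : c ∈ atlas F (RightCosetSpace H))
    {Λ : Distribution F (RightCosetSpace H)} (hΛ : IsInvariant Λ)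
    {f : RightCosetSpace H → K} {U : Set (RightCosetSpace H)} (hU : IsOpen U)
    (hf : ContMDiffOn 𝓘(ℝ, F) 𝓘(ℝ, K) ∞ f U)
    (hfΛ : ∀ x ∈ U, ∀ v : TangentSpace 𝓘(ℝ, F) x,
      v ∈ Λ x ↔ mfderiv 𝓘(ℝ, F) 𝓘(ℝ, K) f x v = 0)
    {y : F} (hy : y ∈ c.target) (hyU : c.symm y ∈ U)
    (a : GroupLieAlgebra 𝓘(ℝ, E) G) (u : F) (hu : fderiv ℝ (f ∘ c.symm) y u = 0) :
    fderiv ℝ (fderiv ℝ (f ∘ c.symm)) y (generatorInChart c a y) u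
      + fderiv ℝ (f ∘ c.symm) y (fderiv ℝ (generatorInChart c a) y u) = 0 := by
  have hcd := mdifferentiable_of_mem_atlas (I := 𝓘(ℝ, F)) hc
  have hgen : generatorInChart c a =ᶠ[𝓝 y]
      fun z => fderiv ℝ (actionInChart E c) (chartAt E (1 : G) 1, z) ((a : E), 0) := by
    filter_upwards [c.open_target.mem_nhds hy] with z hz
    exact generatorInChart_eq_fderiv hπ hc hz a
  rw [hgen.fderiv_eq, hgen.self_of_nhds]
  have hfc : ∀ z ∈ c.target, c.symm z ∈ U → ContDiffAt ℝ ∞ (f ∘ c.symm) z :=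
    fun z hz hzU => contDiffAt_comp_symm hc hz (hf.contMDiffAt (hU.mem_nhds hzU))
  have hfd : ∀ p ∈ U, MDifferentiableAt 𝓘(ℝ, F) 𝓘(ℝ, K) f p := fun p hp =>
    (hf.contMDiffAt (hU.mem_nhds hp)).mdifferentiableAt (by simp)
  have hsd := hcd.mdifferentiableAt_symm hy
  have huΛ : mfderiv 𝓘(ℝ, F) 𝓘(ℝ, F) c.symm y u ∈ Λ (c.symm y) := by
    rw [hfΛ _ hyU]
    exact (fderiv_comp_symm_apply (hfd _ hyU) hsd u).symm.trans hu
  have hΦ := contDiffAt_actionInChart (E := E) hπ hc hy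
  refine lie_derivative_eq_zero (hΦ.of_le (by norm_cast)) ?_
    (((hfc y hy hyU).fderiv_right (m := 1) (by norm_cast)).differentiableAt one_ne_zero) ?_
  · filter_upwards [c.open_target.mem_nhds hy] with z hz
    exact actionInChart_one hz
  have hΦd : ∀ᶠ z in 𝓝 ((chartAt E (1 : G) 1, y) : E × F),
      ContDiffAt ℝ 1 (actionInChart E c) z := (hΦ.of_le (by norm_cast)).eventually (by simp)
  have hin : ∀ᶠ z : E × F in 𝓝 (chartAt E (1 : G) 1, y),
      translate H ((chartAt E (1 : G)).symm z.1) (c.symm z.2) ∈ U ∩ c.source := by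
    refine (contMDiffAt_translate_chart (E := E) hπ hc hy).continuousAt.eventually
      ((hU.inter c.open_source).mem_nhds ?_)
    beta_reduce
    rw [chartAt_symm_chartAt_one, translate_one]
    exact ⟨hyU, c.map_target hy⟩
  have hl : Tendsto (fun e : E => (e, y)) (𝓝 (chartAt E (1 : G) 1))
      (𝓝 (chartAt E (1 : G) 1, y)) := (Continuous.prodMk_left y).tendsto _
  filter_upwards [hl.eventually hΦd, hl.eventually hin.eventually_nhds] with e he he'
  set g := (chartAt E (1 : G)).symm e with hg
  obtain ⟨heU, hec⟩ := he'.self_of_nhds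
  -- `f ∘ c.symm ∘ Φ(e, ·)` is `f` after the translation by `g`
  have h1 : HasFDerivAt (fun z : F => (f ∘ c.symm) (actionInChart E c (e, z)))
      ((fderiv ℝ (f ∘ c.symm) (actionInChart E c (e, y))).comp
        ((fderiv ℝ (actionInChart E c) (e, y)).comp (ContinuousLinearMap.inr ℝ E F))) y := by
    have hd := hfc (actionInChart E c (e, y)) (c.map_source hec) (by
      change c.symm (c _) ∈ U
      rw [c.left_inv hec]
      exact heU)
    exact (hd.differentiableAt (by simp)).hasFDerivAt.comp y
      ((he.differentiableAt one_ne_zero).hasFDerivAt.comp y (hasFDerivAt_prodMk_right e y))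
  have htr : MDifferentiableAt 𝓘(ℝ, F) 𝓘(ℝ, F) (translate H g) (c.symm y) := by
    have h : ContMDiff 𝓘(ℝ, F) 𝓘(ℝ, F) ∞ (translate H g) :=
      (contMDiff_translate hπ).comp (contMDiff_const.prodMk contMDiff_id)
    exact h.contMDiffAt.mdifferentiableAt (by simp)
  have h2 : HasFDerivAt (fun z : F => f (translate H g (c.symm z))) _ y :=
    (HasMFDerivAt.comp y (hfd _ heU).hasMFDerivAt
      (HasMFDerivAt.comp y htr.hasMFDerivAt hsd.hasMFDerivAt)).hasFDerivAt
  have h3 : (fun z : F => f (translate H g (c.symm z))) =ᶠ[𝓝 y]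
      fun z : F => (f ∘ c.symm) (actionInChart E c (e, z)) := by
    filter_upwards [(Continuous.prodMk_right e).tendsto y |>.eventually he'] with z hz
    exact congrArg f (c.left_inv hz.2).symm
  have h4 := DFunLike.congr_fun (h1.unique (h2.congr_of_eventuallyEq h3.symm)) u
  have h5 : mfderiv 𝓘(ℝ, F) 𝓘(ℝ, F) (translate H g) (c.symm y)
      (mfderiv 𝓘(ℝ, F) 𝓘(ℝ, F) c.symm y u) ∈ Λ (translate H g (c.symm y)) := by
    rw [← hΛ g (c.symm y)]
    exact Submodule.mem_map_of_mem huΛ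
  exact h4.trans ((hfΛ _ heU _).1 h5)

end ActionInChart

/-! ### Geodesics perpendicular to an invariant foliation -/

section Local

variable {E F G : Type*}
  [NormedAddCommGroup E] [NormedSpace ℝ E]
  [NormedAddCommGroup F] [NormedSpace ℝ F] [FiniteDimensional ℝ F]
  [TopologicalSpace G] [ChartedSpace E G] [Group G] [LieGroup 𝓘(ℝ, E) ∞ G]
  {H : Subgroup G} [ChartedSpace F (RightCosetSpace H)]
  [IsManifold 𝓘(ℝ, F) ∞ (RightCosetSpace H)]

/-- Near each of its points, a geodesic is everywhere or nowhere perpendicular to an invariant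
foliation. -/
theorem exists_nhds_forall_velocity_mem_perp (hπ : IsQuotientManifold E F H)
    {C : GroupLieAlgebra 𝓘(ℝ, E) G ⊗[ℝ] GroupLieAlgebra 𝓘(ℝ, E) G}
    (hC : TensorProduct.comm ℝ _ _ C = C)
    {Λ : Distribution F (RightCosetSpace H)} (hΛ : IsFoliation Λ) (hΛinv : IsInvariant Λ)
    {J : Set ℝ} {γ : ℝ → RightCosetSpace H} (hJ : IsOpen J)
    (hγ : IsGeodesicOn (metric F H C) (nondegenerateLocus F H C) γ J) {t₁ : ℝ} (ht₁ : t₁ ∈ J) :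
    ∃ N ∈ 𝓝 t₁, ∀ r ∈ N, ∀ t ∈ N,
      velocity (F := F) γ r ∈ perp (metric F H C) Λ (γ r) →
        velocity (F := F) γ t ∈ perp (metric F H C) Λ (γ t) := by
  obtain ⟨k, U, f, hU, hp₁U, hf, hfs⟩ := hΛ (γ t₁)
  obtain ⟨S, hS⟩ := TensorProduct.exists_finset C
  have hfΛ : ∀ x ∈ U, ∀ v : TangentSpace 𝓘(ℝ, F) x,
      v ∈ Λ x ↔ mfderiv 𝓘(ℝ, F) 𝓘(ℝ, EuclideanSpace ℝ (Fin k)) f x v = 0 :=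
    fun x hx => (hfs x hx).2
  have hCswap : C = ∑ i ∈ S, i.2 ⊗ₜ[ℝ] i.1 := by
    rw [← hC, hS]
    simp
  set c := chartAt F (γ t₁) with hcdef
  have hc : c ∈ atlas F (RightCosetSpace H) := chart_mem_atlas F _
  have hcd := mdifferentiable_of_mem_atlas (I := 𝓘(ℝ, F)) hc
  have hp₁ : γ t₁ ∈ c.source := mem_chart_source F _
  have hy₁ : c (γ t₁) ∈ c.target := c.map_source hp₁
  have hfd : ∀ p ∈ U, MDifferentiableAt 𝓘(ℝ, F) 𝓘(ℝ, EuclideanSpace ℝ (Fin k)) f p := fun p hp =>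
    (hf.contMDiffAt (hU.mem_nhds hp)).mdifferentiableAt (by simp)
  have hγt : ∀ᶠ t in 𝓝 t₁, t ∈ J ∧ γ t ∈ c.source ∩ U := by
    refine (hJ.eventually_mem ht₁).and ?_
    exact (hγ.contMDiffOn.contMDiffAt (hJ.mem_nhds ht₁)).continuousAt.eventually
      ((c.open_source.inter hU).mem_nhds ⟨hp₁, hp₁U⟩)
  have hyU : ∀ᶠ y in 𝓝 (c (γ t₁)), y ∈ c.target ∧ c.symm y ∈ U := by
    refine (c.open_target.eventually_mem hy₁).and ?_
    exact (c.continuousAt_symm hy₁).eventually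
      (hU.mem_nhds (by rw [c.left_inv hp₁]; exact hp₁U))
  have hU₁ : c.symm (c (γ t₁)) ∈ U := hyU.self_of_nhds.2
  have hx : ContDiffAt ℝ 2 (fun t => c (γ t)) t₁ := by
    have : IsManifold 𝓘(ℝ, F) 2 (RightCosetSpace H) := IsManifold.of_le (n := ∞) (by norm_cast)
    rw [← contMDiffAt_iff_contDiffAt]
    exact ContMDiffAt.comp t₁ (contMDiffAt_of_mem_maximalAtlas (n := 2)
      (IsManifold.subset_maximalAtlas hc) hp₁)
      (hγ.contMDiffOn.contMDiffAt (hJ.mem_nhds ht₁))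
  obtain ⟨N, hN, h⟩ := exists_nhds_forall_perp_ker (s := S)
    (V := fun i => generatorInChart c i.1) (W := fun i => generatorInChart c i.2)
    (D := fderiv ℝ (f ∘ c.symm)) (m := metricInChart (metric F H C) c) (x := fun t => c (γ t))
    (fun i _ => contDiffAt_generatorInChart hπ hc hy₁ i.1)
    (fun i _ => contDiffAt_generatorInChart hπ hc hy₁ i.2)
    ((contDiffAt_comp_symm hc hy₁ (hf.contMDiffAt (hU.mem_nhds hU₁))).fderiv_right (by norm_cast))
    (by
      intro w
      obtain ⟨v, hv⟩ := (hfs _ hU₁).1 w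
      obtain ⟨u, hu⟩ := hcd.symm.mfderiv_surjective hy₁ v
      exact ⟨u, (fderiv_comp_symm_apply (hfd _ hU₁) (hcd.mdifferentiableAt_symm hy₁) u).trans
        ((congrArg _ hu).trans hv)⟩)
    hx
    (Eventually.of_forall fun y ξ => by
      rw [cometric_generatorInChart, cometric_generatorInChart, ← hS, ← hCswap])
    (by
      rw [bijective_cometric_iff hcd _ _ _ hy₁, ← hS, c.left_inv hp₁]
      exact hγ.mapsTo ht₁)
    (hyU.mono fun y hy hb ξ v => by
      have h := metricInChart_cometric hcd S (fun i => i.1) (fun i => i.2) hy.1 hb ξ v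
      rwa [← hS] at h)
    (fun i _ => hyU.mono fun y hy u hu =>
      lie_derivative_generatorInChart hπ hc hΛinv hU hf hfΛ hy.1 hy.2 i.1 u hu)
    (fun i _ => hyU.mono fun y hy u hu =>
      lie_derivative_generatorInChart hπ hc hΛinv hU hf hfΛ hy.1 hy.2 i.2 u hu)
    (hγt.mono fun t ht w => hγ.geodesic_eq c hc t ht.1 ht.2.1 w)
  obtain ⟨N', hN', hgood⟩ := hγt.exists_mem
  -- perpendicularity of the velocity, in the chart
  have hperp : ∀ t ∈ N', velocity (F := F) γ t ∈ perp (metric F H C) Λ (γ t) ↔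
      ∀ u, fderiv ℝ (f ∘ c.symm) (c (γ t)) u = 0 →
        metricInChart (metric F H C) c (c (γ t)) (deriv (fun t => c (γ t)) t) u = 0 := by
    intro t ht
    obtain ⟨htJ, hts, htU⟩ := hgood t ht
    have hyt := c.map_source hts
    have hvel : (mfderiv 𝓘(ℝ, F) 𝓘(ℝ, F) c (γ t) (velocity (F := F) γ t) : F)
        = deriv (fun t => c (γ t)) t := by
      have h := (HasMFDerivAt.comp t (hcd.mdifferentiableAt hts).hasMFDerivAt
        ((hγ.contMDiffOn.contMDiffAt (hJ.mem_nhds htJ)).mdifferentiableAt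
          (by simp)).hasMFDerivAt).hasFDerivAt
      have key : ∀ L : ℝ →L[ℝ] F, HasFDerivAt (fun t => c (γ t)) L t →
          L 1 = deriv (fun t => c (γ t)) t := fun L hL => hL.hasDerivAt.deriv.symm
      exact key _ h
    have hUt : c.symm (c (γ t)) ∈ U := by rwa [c.left_inv hts]
    rw [mem_perp_iff hcd hyt (c.left_inv hts), hvel]
    refine forall_congr' fun u => imp_congr ((hfΛ _ hUt _).trans ?_) Iff.rfl
    have e := fderiv_comp_symm_apply (hfd _ hUt) (hcd.mdifferentiableAt_symm hyt) (u : F)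
    exact ⟨fun h => e.trans h, fun h => e.symm.trans h⟩
  refine ⟨N ∩ N', inter_mem hN hN', fun r hr t ht hrp => ?_⟩
  exact (hperp t ht.2).2 (h r hr.1 t ht.1 ((hperp r hr.2).1 hrp))

end Local

end LieAlgebraicMetric

/-- Let `G` be a real Lie group, `H` a closed subgroup, `C ∈ Sym² 𝔤`, and regard the locus in
`H \ G` where the tensor field of `C` is non-degenerate as a pseudo-Riemannian manifold. If `Λ` is
a `G`-invariant foliation, then `Λ^⊥` is totally geodesic. -/
theorem mainTheorem3 {E F G : Type*}
    [NormedAddCommGroup E] [NormedSpace ℝ E] [FiniteDimensional ℝ E]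
    [NormedAddCommGroup F] [NormedSpace ℝ F] [FiniteDimensional ℝ F]
    [TopologicalSpace G] [ChartedSpace E G] [Group G] [LieGroup 𝓘(ℝ, E) ∞ G]
    (H : Subgroup G) (_hH : IsClosed (H : Set G))
    [ChartedSpace F (LieAlgebraicMetric.RightCosetSpace H)]
    [IsManifold 𝓘(ℝ, F) ∞ (LieAlgebraicMetric.RightCosetSpace H)]
    (_hM : LieAlgebraicMetric.IsQuotientManifold E F H)
    (C : GroupLieAlgebra 𝓘(ℝ, E) G ⊗[ℝ] GroupLieAlgebra 𝓘(ℝ, E) G)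
    (_hC : TensorProduct.comm ℝ _ _ C = C)
    (Λ : LieAlgebraicMetric.Distribution F (LieAlgebraicMetric.RightCosetSpace H))
    (_hΛ : LieAlgebraicMetric.IsFoliation Λ)
    (_hΛ_inv : LieAlgebraicMetric.IsInvariant Λ) :
    LieAlgebraicMetric.IsTotallyGeodesicOn
      (LieAlgebraicMetric.metric F H C)
      (LieAlgebraicMetric.nondegenerateLocus F H C)
      (LieAlgebraicMetric.perp (LieAlgebraicMetric.metric F H C) Λ) := by
  intro J γ hJ hJc hγ ⟨t₀, ht₀, h₀⟩ t ht
  refine hJc.induction₂' (fun r s =>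
    LieAlgebraicMetric.velocity (F := F) γ r ∈
        LieAlgebraicMetric.perp (LieAlgebraicMetric.metric F H C) Λ (γ r) →
      LieAlgebraicMetric.velocity (F := F) γ s ∈
        LieAlgebraicMetric.perp (LieAlgebraicMetric.metric F H C) Λ (γ s))
    (fun r hr => ?_) (fun _ _ _ _ _ _ h h' => h' ∘ h) ht₀ ht h₀
  obtain ⟨N, hN, h⟩ := LieAlgebraicMetric.exists_nhds_forall_velocity_mem_perp
    _hM _hC _hΛ _hΛ_inv hJ hγ hr
  filter_upwards [mem_nhdsWithin_of_mem_nhds hN] with s hs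
  exact ⟨h r (mem_of_mem_nhds hN) s hs, h s hs r (mem_of_mem_nhds hN)⟩
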